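/- Let $\omega$ be the exponent of matrix multiplication (over an arbitrary fixed nontrivial commutative ring, e.g. $\mathbb{Z}$ or $\mathbb{Q}$), i.e. the smallest constant such that two $n\times n$ matrices can be multiplied with $n^{\omega+o(1)}$ arithmetic operations. For a finite simple graph $G$ let $n$, $m$ and $T$ be its numbers of vertices, edges and triangles. Consider randomized algorithms (programs of a random access machine) that are given $n$ and $m$ and that may, in unit time each, obtain the $i$-th vertex, the degree of a vertex, the $j$-th neighbor of a vertex, whether two vertices are adjacent, and the $i$-th edge, and may also sample a uniformly random vertex, a uniformly random edge, or a uniformly random neighbor of a vertex. Let $\delta$ be a real constant. Suppose there are such an algorithm and a constant $c\ge 1$ such that on every graph with $T\ge 1$, however the neighbors and edges are ordered, the algorithm outputs, with probability at least $2/3$, a number $\hat T$ with $T/c\le \hat T\le cT$, and such that on graphs with $T\ge 1$ its expected running time is $$\tilde O\!\left(\frac{m^{2\omega/(\omega+1)}}{T^{\delta}}\right),$$ where $\tilde O(f)$ means $O(f\cdot n^{o(1)})$ as $n\to\infty$, uniformly in the graph. Then $$\delta\le \frac{2(\omega-1)}{\omega+1}.$$ -/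

import Mathlib

open Filter Topology
open scoped ENNReal

noncomputable section

namespace TriangleCounting

/-! ### The exponent of matrix multiplication -/

/-- `ArithComputes R t S`: starting from the variables and the constants of `R`, some
straight-line program of exactly `t` arithmetic operations has all elements of `S` at hand
(inputs, constants and intermediate results). -/
inductive ArithComputes (R : Type*) [CommRing R] {σ : Type*} :
    ℕ → Set (MvPolynomial σ R) → Prop
  | start : ArithComputes R 0 (Set.range MvPolynomial.X ∪ Set.range MvPolynomial.C)
  | add {t : ℕ} {S : Set (MvPolynomial σ R)} {f g : MvPolynomial σ R} :
      ArithComputes R t S → f ∈ S → g ∈ S → ArithComputes R (t + 1) (insert (f + g) S)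
  | sub {t : ℕ} {S : Set (MvPolynomial σ R)} {f g : MvPolynomial σ R} :
      ArithComputes R t S → f ∈ S → g ∈ S → ArithComputes R (t + 1) (insert (f - g) S)
  | mul {t : ℕ} {S : Set (MvPolynomial σ R)} {f g : MvPolynomial σ R} :
      ArithComputes R t S → f ∈ S → g ∈ S → ArithComputes R (t + 1) (insert (f * g) S)

/-- The first generic `n × n` matrix, whose entries are distinct variables. -/
def leftMatrix (R : Type*) [CommRing R] (n : ℕ) :
    Matrix (Fin n) (Fin n) (MvPolynomial ((Fin n × Fin n) ⊕ (Fin n × Fin n)) R) :=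
  Matrix.of fun i j => MvPolynomial.X (Sum.inl (i, j))

/-- The second generic `n × n` matrix. -/
def rightMatrix (R : Type*) [CommRing R] (n : ℕ) :
    Matrix (Fin n) (Fin n) (MvPolynomial ((Fin n × Fin n) ⊕ (Fin n × Fin n)) R) :=
  Matrix.of fun i j => MvPolynomial.X (Sum.inr (i, j))

/-- Two `n × n` matrices over `R` can be multiplied with `t` arithmetic operations. -/
def CanMultiply (R : Type*) [CommRing R] (n t : ℕ) : Prop :=
  ∃ S, ArithComputes R t S ∧ ∀ i j, (leftMatrix R n * rightMatrix R n) i j ∈ S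

/-- The exponent `ω` of matrix multiplication over `R`: the smallest `τ` such that two `n × n`
matrices can be multiplied with at most `n ^ (τ + o(1))` arithmetic operations. -/
def matMulExponent (R : Type*) [CommRing R] : ℝ :=
  sInf {τ : ℝ | ∀ ε > 0, ∀ᶠ n : ℕ in atTop,
    ∃ t : ℕ, CanMultiply R n t ∧ (t : ℝ) ≤ (n : ℝ) ^ (τ + ε)}

/-! ### Input graphs and queries -/

/-- An input: a finite simple graph with vertices `0, …, n - 1`, stored as an array of neighbours
for each vertex and an array of edges, all in an arbitrary order. -/
structure GraphInput where
  n : ℕ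
  graph : SimpleGraph (Fin n)
  adj : Fin n → List (Fin n)
  adj_nodup : ∀ v, (adj v).Nodup
  mem_adj : ∀ v w, w ∈ adj v ↔ graph.Adj v w
  edges : List (Fin n × Fin n)
  edges_nodup : (edges.map fun e => s(e.1, e.2)).Nodup
  mem_edges : ∀ e : Sym2 (Fin n), e ∈ edges.map (fun e => s(e.1, e.2)) ↔ e ∈ graph.edgeSet

namespace GraphInput

variable (I : GraphInput)

/-- The number `m` of edges. -/
def m : ℕ := I.graph.edgeSet.ncard

/-- The number `T` of triangles. -/
def T : ℕ := (I.graph.cliqueSet 3).ncard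

/-- The `i`-th vertex (`n`, which is not a vertex, if there is none). -/
def vertexQuery (i : ℕ) : ℕ := if i < I.n then i else I.n

/-- The degree of `v` (`0` if `v` is not a vertex). -/
def degreeQuery (v : ℕ) : ℕ :=
  if h : v < I.n then (I.adj ⟨v, h⟩).length else 0

/-- The `i`-th neighbour of `v` (`n` if there is none). -/
def neighborQuery (v i : ℕ) : ℕ :=
  if h : v < I.n then ((I.adj ⟨v, h⟩)[i]?).elim I.n (fun w => (w : ℕ)) else I.n

open Classical in
/-- Whether `u` and `v` are adjacent (`1` for yes, `0` for no). -/
def pairQuery (u v : ℕ) : ℕ :=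
  if ∃ (hu : u < I.n) (hv : v < I.n), I.graph.Adj ⟨u, hu⟩ ⟨v, hv⟩ then 1 else 0

/-- The two endpoints of the `i`-th edge (`(n, n)` if there is none). -/
def edgeQuery (i : ℕ) : ℕ × ℕ :=
  (I.edges[i]?).elim (I.n, I.n) (fun e => ((e.1 : ℕ), (e.2 : ℕ)))

end GraphInput

/-! ### Randomized random access machines with access to a graph -/

/-- The arithmetic, logical and shift operations of the machine. -/
inductive BinOp
  | add | sub | mul | div | mod | land | lor | xor | shl | shr

/-- The value of an operation on natural numbers (`sub` truncates). -/
def BinOp.eval : BinOp → ℕ → ℕ → ℕ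
  | .add, x, y => x + y
  | .sub, x, y => x - y
  | .mul, x, y => x * y
  | .div, x, y => x / y
  | .mod, x, y => x % y
  | .land, x, y => x &&& y
  | .lor, x, y => x ||| y
  | .xor, x, y => x ^^^ y
  | .shl, x, y => x <<< y
  | .shr, x, y => x >>> y

/-- Instructions. All arguments other than the constant `k` and the jump targets `l` are
addresses of memory cells; results are written to `d` (and `d'`). Each instruction takes one
unit of time. -/
inductive Instr
  /-- `M[d] := k` -/
  | const (d k : ℕ)
  /-- `M[d] := M[a] op M[b]` -/
  | op (o : BinOp) (d a b : ℕ)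
  /-- `M[d] := M[M[a]]` -/
  | load (d a : ℕ)
  /-- `M[M[a]] := M[b]` -/
  | store (a b : ℕ)
  /-- go to `l` -/
  | jump (l : ℕ)
  /-- go to `l` if `M[a] < M[b]` -/
  | jumpLt (a b l : ℕ)
  /-- `M[d] :=` a uniformly random natural number below `M[a]` -/
  | rand (d a : ℕ)
  /-- `M[d] :=` the `M[i]`-th vertex -/
  | vertex (d i : ℕ)
  /-- `M[d] :=` the degree of `M[v]` -/
  | degree (d v : ℕ)
  /-- `M[d] :=` the `M[i]`-th neighbour of `M[v]` -/
  | neighbor (d v i : ℕ)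
  /-- `M[d] := 1` or `0`, according to whether `M[u]` and `M[v]` are adjacent -/
  | pair (d u v : ℕ)
  /-- `M[d], M[d'] :=` the endpoints of the `M[i]`-th edge -/
  | edge (d d' i : ℕ)
  /-- `M[d] :=` a uniformly random vertex -/
  | randVertex (d : ℕ)
  /-- `M[d] :=` a uniformly random neighbour of `M[v]` -/
  | randNeighbor (d v : ℕ)
  /-- `M[d], M[d'] :=` the endpoints of a uniformly random edge -/
  | randEdge (d d' : ℕ)

/-- An algorithm is a finite program, the same for inputs of all sizes. -/
abbrev Program := List Instr

/-- A configuration: the program counter and the contents of the memory. -/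
structure Config where
  pc : ℕ
  mem : ℕ → ℕ

/-- Write `x` to cell `d` and go to the next instruction. -/
def Config.write (c : Config) (d x : ℕ) : Config :=
  ⟨c.pc + 1, Function.update c.mem d x⟩

/-- Write `x.1` to cell `d` and `x.2` to cell `d'` and go to the next instruction. -/
def Config.write₂ (c : Config) (d d' : ℕ) (x : ℕ × ℕ) : Config :=
  ⟨c.pc + 1, Function.update (Function.update c.mem d x.1) d' x.2⟩

/-- The uniform distribution on the natural numbers below `b` (the point mass at `0` if
`b = 0`). -/
def uniformBelow : ℕ → PMF ℕ
  | 0 => PMF.pure 0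
  | b + 1 => (PMF.uniformOfFintype (Fin (b + 1))).map (fun i => (i : ℕ))

/-- The distribution of the configuration one time step after `c`. The machine has halted, and
stays in its configuration, once the program counter is outside the program. -/
def step (p : Program) (I : GraphInput) (c : Config) : PMF Config :=
  match p[c.pc]? with
  | none => PMF.pure c
  | some (.const d k) => PMF.pure (c.write d k)
  | some (.op o d a b) => PMF.pure (c.write d (o.eval (c.mem a) (c.mem b)))
  | some (.load d a) => PMF.pure (c.write d (c.mem (c.mem a)))
  | some (.store a b) => PMF.pure (c.write (c.mem a) (c.mem b))
  | some (.jump l) => PMF.pure ⟨l, c.mem⟩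
  | some (.jumpLt a b l) => PMF.pure ⟨if c.mem a < c.mem b then l else c.pc + 1, c.mem⟩
  | some (.rand d a) => (uniformBelow (c.mem a)).map (c.write d)
  | some (.vertex d i) => PMF.pure (c.write d (I.vertexQuery (c.mem i)))
  | some (.degree d v) => PMF.pure (c.write d (I.degreeQuery (c.mem v)))
  | some (.neighbor d v i) => PMF.pure (c.write d (I.neighborQuery (c.mem v) (c.mem i)))
  | some (.pair d u v) => PMF.pure (c.write d (I.pairQuery (c.mem u) (c.mem v)))
  | some (.edge d d' i) => PMF.pure (c.write₂ d d' (I.edgeQuery (c.mem i)))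
  | some (.randVertex d) =>
      (uniformBelow I.n).map fun i => c.write d (I.vertexQuery i)
  | some (.randNeighbor d v) =>
      (uniformBelow (I.degreeQuery (c.mem v))).map fun i =>
        c.write d (I.neighborQuery (c.mem v) i)
  | some (.randEdge d d') =>
      (uniformBelow I.m).map fun i => c.write₂ d d' (I.edgeQuery i)

/-- At the start, cell `0` holds `n`, cell `1` holds `m`, and all other cells hold `0`. -/
def initial (I : GraphInput) : Config :=
  ⟨0, fun a => if a = 0 then I.n else if a = 1 then I.m else 0⟩

/-- The distribution of the configuration after `t` time steps. -/
def run (p : Program) (I : GraphInput) : ℕ → PMF Config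
  | 0 => PMF.pure (initial I)
  | t + 1 => (run p I t).bind (step p I)

/-- The machine has halted. -/
def Halted (p : Program) (c : Config) : Prop := p.length ≤ c.pc

/-- The output is the rational number `M[0] / M[1]`. -/
def output (c : Config) : ℝ := (c.mem 0 : ℝ) / (c.mem 1 : ℝ)

/-- The expected running time, as the sum over `t` of the probability that the machine has not
halted within `t` time steps. -/
def expectedTime (p : Program) (I : GraphInput) : ℝ≥0∞ :=
  ∑' t : ℕ, (run p I t).toOuterMeasure {c | ¬ Halted p c}

/-- The probability that the machine halts with an output in `A`. -/
def outputProb (p : Program) (I : GraphInput) (A : Set ℝ) : ℝ≥0∞ :=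
  ⨆ t : ℕ, (run p I t).toOuterMeasure {c | Halted p c ∧ output c ∈ A}

/-- For some constant `c ≥ 1`, on every graph with at least one triangle the output is, with
probability at least `2/3`, within a factor `c` of the number `T` of triangles. -/
def IsConstantFactorApprox (p : Program) : Prop :=
  ∃ c : ℝ, 1 ≤ c ∧ ∀ I : GraphInput, 0 < I.T →
    2 / 3 ≤ outputProb p I (Set.Icc ((I.T : ℝ) / c) (c * (I.T : ℝ)))

/-- The (expected) running time is `Õ(f(m, T))`, that is `O(n ^ o(1) * f(m, T))`, on graphs with
at least one triangle. -/
def RunsInSoftO (p : Program) (f : ℕ → ℕ → ℝ) : Prop :=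
  ∃ (C : ℝ) (e : ℕ → ℝ) (N : ℕ), Tendsto e atTop (𝓝 0) ∧
    ∀ I : GraphInput, N ≤ I.n → 0 < I.T →
      expectedTime p I ≤ ENNReal.ofReal (C * (I.n : ℝ) ^ e I.n * f I.m I.T)

end TriangleCounting

end

/-! The bound comes from an unconditional lower bound: at `T ≈ √m`, a constant factor approximation
needs time of order `m`. With `m ≈ h ^ 2` and `T ≈ h`, the assumed time is `h ^ (2 * a - δ)` up to
`h ^ o(1)`, where `a = 2ω / (ω + 1)`. Hence `2 ≤ 2 * a - δ` (`two_le_of_approx`), which rearranges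
to the claim.

The hard inputs are double covers of a clique on `2h` vertices plus a disjoint triangle. A base
triangle lifts to triangles exactly when an odd number of its edges lie in the sign-preserving set
`S`. Marking one edge of the extra triangle gives a positive, bounded number of triangles; marking
one clique edge as well gives order `h` more. Changing `S` alters neither degrees nor list orders,
and any other query concerns a single base edge. So each query separates the base input from at most
one of the `h ^ 2` hard inputs (`conceals_insert`).

A coupling turns this into a time bound: over `t` steps, the errors in replacing a hard input by the
base input sum to at most `t` over all hard inputs (`Conceals.exists_run_bound`), while correctness
forces each error to be at least `1/6` (`Conceals.card_le`). -/

namespace TriangleCounting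

/-! ### Expectations under discrete distributions -/

section Expect

variable {α β ι : Type*}

/-- The expectation of `f` under `μ`. -/
noncomputable def expect (μ : PMF α) (f : α → ℝ≥0∞) : ℝ≥0∞ := ∑' x, μ x * f x

theorem expect_mono (μ : PMF α) {f g : α → ℝ≥0∞} (h : ∀ x, f x ≤ g x) :
    expect μ f ≤ expect μ g :=
  ENNReal.tsum_le_tsum fun x => mul_le_mul_right (h x) _

theorem expect_add (μ : PMF α) (f g : α → ℝ≥0∞) :
    expect μ (fun x => f x + g x) = expect μ f + expect μ g := by
  simp only [expect, mul_add, ENNReal.tsum_add]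

theorem expect_const (μ : PMF α) (a : ℝ≥0∞) : expect μ (fun _ => a) = a := by
  simp only [expect, ENNReal.tsum_mul_right, μ.tsum_coe, one_mul]

theorem expect_le_one (μ : PMF α) {f : α → ℝ≥0∞} (h : ∀ x, f x ≤ 1) : expect μ f ≤ 1 :=
  (expect_mono μ h).trans (expect_const μ 1).le

theorem expect_pure (a : α) (f : α → ℝ≥0∞) : expect (PMF.pure a) f = f a := by
  rw [expect, tsum_eq_single a]
  · simp
  · intro b hb
    simp [hb]

theorem expect_bind (μ : PMF α) (k : α → PMF β) (f : β → ℝ≥0∞) :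
    expect (μ.bind k) f = expect μ fun x => expect (k x) f := by
  simp only [expect, PMF.bind_apply, ← ENNReal.tsum_mul_right, ← ENNReal.tsum_mul_left]
  rw [ENNReal.tsum_comm]
  simp only [mul_assoc]

theorem expect_map (μ : PMF α) (g : α → β) (f : β → ℝ≥0∞) :
    expect (μ.map g) f = expect μ fun x => f (g x) := by
  rw [PMF.map, expect_bind]
  simp only [Function.comp_apply, expect_pure]

theorem tsum_expect (μ : PMF α) (f : ι → α → ℝ≥0∞) :
    ∑' z, expect μ (f z) = expect μ fun x => ∑' z, f z x := by
  simp only [expect, ← ENNReal.tsum_mul_left]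
  rw [ENNReal.tsum_comm]

theorem toOuterMeasure_eq_expect (μ : PMF α) (S : Set α) :
    μ.toOuterMeasure S = expect μ (S.indicator 1) := by
  rw [PMF.toOuterMeasure_apply, expect]
  refine tsum_congr fun x => ?_
  by_cases h : x ∈ S <;> simp [h]

theorem indicator_one_le_one (S : Set α) (x : α) : S.indicator (1 : α → ℝ≥0∞) x ≤ 1 :=
  Set.indicator_le_self' (fun _ _ => zero_le) x

theorem tsum_indicator_le_one {S : Set ι} (hS : S.Subsingleton) :
    ∑' z, S.indicator (1 : ι → ℝ≥0∞) z ≤ 1 := by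
  rcases hS.eq_empty_or_singleton with rfl | ⟨a, rfl⟩
  · simp
  · rw [tsum_eq_single a]
    · simp
    · intro b hb
      simp [hb]

/-- Functions of one random variable that differ at each point for at most one index `z` have
distributions whose distances to the unperturbed one add up to at most `1`. -/
theorem exists_perturbation_bound (μ : PMF α) (F : α → β) (G : ι → α → β)
    (h : ∀ i, {z | G z i ≠ F i}.Subsingleton) :
    ∃ d : ι → ℝ≥0∞, ∑' z, d z ≤ 1 ∧ ∀ z (f : β → ℝ≥0∞), (∀ x, f x ≤ 1) →
      expect (μ.map (G z)) f ≤ expect (μ.map F) f + d z := by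
  -- The bound for `z` is the probability that `G z` and `F` disagree on the shared sample.
  refine ⟨fun z => expect μ fun i => {z | G z i ≠ F i}.indicator 1 z, ?_, fun z f hf => ?_⟩
  · rw [tsum_expect]
    exact expect_le_one μ fun i => tsum_indicator_le_one (h i)
  · rw [expect_map, expect_map, ← expect_add]
    refine expect_mono μ fun i => ?_
    by_cases hi : G z i = F i
    · rw [hi]
      exact le_self_add
    · have : z ∈ {z | G z i ≠ F i} := hi
      rw [Set.indicator_of_mem this]
      exact (hf _).trans le_add_self

end Expect

/-! ### Inputs that no single query tells apart from many others -/

/-- The inputs `J z` have the parameters and degrees of `I`, and every other query is answered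
differently from `I` on at most one of them. -/
structure Conceals {ι : Type*} (I : GraphInput) (J : ι → GraphInput) : Prop where
  n_eq : ∀ z, (J z).n = I.n
  m_eq : ∀ z, (J z).m = I.m
  degree_eq : ∀ z v, (J z).degreeQuery v = I.degreeQuery v
  neighbor : ∀ v i, {z | (J z).neighborQuery v i ≠ I.neighborQuery v i}.Subsingleton
  pair : ∀ u v, {z | (J z).pairQuery u v ≠ I.pairQuery u v}.Subsingleton
  edge : ∀ i, {z | (J z).edgeQuery i ≠ I.edgeQuery i}.Subsingleton

namespace Conceals

variable {ι : Type*} {I : GraphInput} {J : ι → GraphInput}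

theorem vertexQuery_eq (h : Conceals I J) (z : ι) : (J z).vertexQuery = I.vertexQuery := by
  funext i
  simp only [GraphInput.vertexQuery, h.n_eq]

theorem initial_eq (h : Conceals I J) (z : ι) : initial (J z) = initial I := by
  simp only [initial, h.n_eq, h.m_eq]

/-- A coupling of one step on all inputs: random choices have the same range everywhere because `n`,
`m` and the degrees agree, so only the looked-up answer can differ. -/
theorem exists_step_eq_map (h : Conceals I J) (p : Program) (c : Config) :
    ∃ (μ : PMF ℕ) (F : ℕ → Config) (G : ι → ℕ → Config), step p I c = μ.map F ∧
      (∀ z, step p (J z) c = μ.map (G z)) ∧ ∀ i, {z | G z i ≠ F i}.Subsingleton := by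
  have det : ∀ (F : Config) (G : ι → Config), step p I c = PMF.pure F →
      (∀ z, step p (J z) c = PMF.pure (G z)) → {z | G z ≠ F}.Subsingleton →
      ∃ (μ : PMF ℕ) (F : ℕ → Config) (G : ι → ℕ → Config), step p I c = μ.map F ∧
      (∀ z, step p (J z) c = μ.map (G z)) ∧ ∀ i, {z | G z i ≠ F i}.Subsingleton := by
    intro F G hF hG hs
    refine ⟨PMF.pure 0, fun _ => F, fun z _ => G z, ?_, fun z => ?_, fun _ => hs⟩
    · rw [hF, PMF.pure_map]
    · rw [hG, PMF.pure_map]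
  have same : ∀ (μ : PMF ℕ) (F : ℕ → Config), step p I c = μ.map F →
      (∀ z, step p (J z) c = μ.map F) →
      ∃ (μ : PMF ℕ) (F : ℕ → Config) (G : ι → ℕ → Config), step p I c = μ.map F ∧
      (∀ z, step p (J z) c = μ.map (G z)) ∧ ∀ i, {z | G z i ≠ F i}.Subsingleton := by
    intro μ F hF hG
    exact ⟨μ, F, fun _ => F, hF, hG, fun i => by simp⟩
  have nil : ∀ F : Config, {z : ι | F ≠ F}.Subsingleton := fun F => by simp
  have sub : ∀ {γ : Type} (g : γ → Config) (u : γ) (w : ι → γ), {z | w z ≠ u}.Subsingleton →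
      {z | g (w z) ≠ g u}.Subsingleton := fun g u w hs =>
    hs.anti fun z hz hw => hz (congrArg g hw)
  rcases hc : p[c.pc]? with _ | i
  · exact det c (fun _ => c) (by simp only [step, hc]) (fun z => by simp only [step, hc]) (nil _)
  · rcases i with ⟨d, k⟩ | ⟨o, d, a, b⟩ | ⟨d, a⟩ | ⟨a, b⟩ | l | ⟨a, b, l⟩ | ⟨d, a⟩ | ⟨d, i⟩ |
      ⟨d, v⟩ | ⟨d, v, i⟩ | ⟨d, u, v⟩ | ⟨d, d', i⟩ | d | ⟨d, v⟩ | ⟨d, d'⟩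
    case neighbor =>
      exact det _ (fun z => c.write d ((J z).neighborQuery (c.mem v) (c.mem i)))
        (by simp only [step, hc]) (fun z => by simp only [step, hc])
        (sub (c.write d) _ _ (h.neighbor _ _))
    case pair =>
      exact det _ (fun z => c.write d ((J z).pairQuery (c.mem u) (c.mem v)))
        (by simp only [step, hc]) (fun z => by simp only [step, hc])
        (sub (c.write d) _ _ (h.pair _ _))
    case edge =>
      exact det _ (fun z => c.write₂ d d' ((J z).edgeQuery (c.mem i)))
        (by simp only [step, hc]) (fun z => by simp only [step, hc])
        (sub (c.write₂ d d') _ _ (h.edge _))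
    case rand =>
      exact same (uniformBelow (c.mem a)) (c.write d)
        (by simp only [step, hc]) (fun z => by simp only [step, hc])
    case randVertex =>
      exact same (uniformBelow I.n) (fun i => c.write d (I.vertexQuery i))
        (by simp only [step, hc])
        (fun z => by simp only [step, hc, h.n_eq, h.vertexQuery_eq])
    case randNeighbor =>
      exact ⟨uniformBelow (I.degreeQuery (c.mem v)), _,
        fun z i => c.write d ((J z).neighborQuery (c.mem v) i),
        by simp only [step, hc], fun z => by simp only [step, hc, h.degree_eq],
        fun i => sub (c.write d) _ _ (h.neighbor _ _)⟩
    case randEdge =>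
      exact ⟨uniformBelow I.m, _, fun z i => c.write₂ d d' ((J z).edgeQuery i),
        by simp only [step, hc], fun z => by simp only [step, hc, h.m_eq],
        fun i => sub (c.write₂ d d') _ _ (h.edge _)⟩
    all_goals
      exact det _ _ (by simp only [step, hc]; rfl)
        (fun z => by simp only [step, hc, h.degree_eq, h.vertexQuery_eq]) (nil _)

/-- Adaptivity does no harm: the one-step errors are averaged over the run on `I`, which is the same
for every `z`, so each step adds at most `1` to the sum. -/
theorem exists_run_bound (h : Conceals I J) (p : Program) (t : ℕ) :
    ∃ d : ι → ℝ≥0∞, ∑' z, d z ≤ t ∧ ∀ z (f : Config → ℝ≥0∞), (∀ x, f x ≤ 1) →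
      expect (run p (J z) t) f ≤ expect (run p I t) f + d z := by
  have hstep : ∀ c, ∃ d : ι → ℝ≥0∞, ∑' z, d z ≤ 1 ∧ ∀ z (f : Config → ℝ≥0∞), (∀ x, f x ≤ 1) →
      expect (step p (J z) c) f ≤ expect (step p I c) f + d z := by
    intro c
    obtain ⟨μ, F, G, hF, hG, hs⟩ := h.exists_step_eq_map p c
    obtain ⟨d, hd, hf⟩ := exists_perturbation_bound μ F G hs
    exact ⟨d, hd, fun z f => by rw [hF, hG]; exact hf z f⟩
  choose δ hδ hstep using hstep
  induction t with
  | zero =>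
    refine ⟨0, by simp, fun z f _ => ?_⟩
    simp only [run, h.initial_eq]
    exact le_self_add
  | succ t ih =>
    obtain ⟨d, hd, ih⟩ := ih
    refine ⟨fun z => expect (run p I t) (fun c => δ c z) + d z, ?_, fun z f hf => ?_⟩
    · rw [ENNReal.tsum_add, tsum_expect, Nat.cast_succ, add_comm]
      exact add_le_add hd (expect_le_one _ hδ)
    · simp only [run, expect_bind]
      refine (ih z _ fun c => expect_le_one _ hf).trans ?_
      rw [← add_assoc, ← expect_add]
      exact add_le_add_left (expect_mono _ fun c => hstep c z f hf) _

end Conceals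

/-! ### Halting -/

theorem step_of_halted {p : Program} (I : GraphInput) {c : Config} (h : Halted p c) :
    step p I c = PMF.pure c := by
  have : p[c.pc]? = none := List.getElem?_eq_none h
  simp only [step, this]

theorem monotone_run_of_halted (p : Program) (I : GraphInput) {B : Set Config}
    (hB : ∀ c ∈ B, Halted p c) : Monotone fun t => (run p I t).toOuterMeasure B := by
  refine monotone_nat_of_le_succ fun t => ?_
  simp only [toOuterMeasure_eq_expect, run, expect_bind]
  refine expect_mono _ fun c => ?_
  by_cases hc : c ∈ B
  · rw [step_of_halted I (hB c hc), expect_pure]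
  · simp [hc]

/-- A configuration outside `B` is frozen, so `B` can be left but never entered. -/
theorem antitone_run_of_not_halted (p : Program) (I : GraphInput) {B : Set Config}
    (hB : ∀ c, c ∉ B → Halted p c) : Antitone fun t => (run p I t).toOuterMeasure B := by
  refine antitone_nat_of_succ_le fun t => ?_
  simp only [toOuterMeasure_eq_expect, run, expect_bind]
  refine expect_mono _ fun c => ?_
  by_cases hc : c ∈ B
  · rw [Set.indicator_of_mem hc]
    exact expect_le_one _ (indicator_one_le_one B)
  · rw [step_of_halted I (hB c hc), expect_pure]

/-- Markov's inequality: each of the first `t + 1` terms of the sum is at least the last of them. -/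
theorem mul_not_halted_le_expectedTime (p : Program) (I : GraphInput) (t : ℕ) :
    ((t + 1 : ℕ) : ℝ≥0∞) * (run p I t).toOuterMeasure {c | ¬ Halted p c} ≤ expectedTime p I := by
  refine le_trans ?_ (ENNReal.sum_le_tsum (Finset.range (t + 1)))
  rw [← nsmul_eq_mul]
  have := Finset.card_nsmul_le_sum (Finset.range (t + 1))
    (fun s => (run p I s).toOuterMeasure {c | ¬ Halted p c})
    ((run p I t).toOuterMeasure {c | ¬ Halted p c}) fun s hs =>
      antitone_run_of_not_halted p I (B := {c | ¬ Halted p c}) (fun c hc => not_not.mp hc)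
        (Nat.lt_succ_iff.mp (Finset.mem_range.mp hs))
  rwa [Finset.card_range] at this

theorem outputProb_le (p : Program) (I : GraphInput) (A : Set ℝ) (t : ℕ) :
    outputProb p I A ≤ (run p I t).toOuterMeasure {c | Halted p c ∧ output c ∈ A} +
      (run p I t).toOuterMeasure {c | ¬ Halted p c} := by
  refine iSup_le fun s => ?_
  refine le_trans ?_ (MeasureTheory.measure_union_le _ _)
  rcases le_total s t with hst | hst
  · exact (monotone_run_of_halted p I (fun c hc => hc.1) hst).trans
      (MeasureTheory.measure_mono Set.subset_union_left)
  · refine le_trans (MeasureTheory.measure_mono Set.subset_union_left)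
      (antitone_run_of_not_halted p I (B := {c | Halted p c ∧ output c ∈ A} ∪ {c | ¬ Halted p c})
        (fun c hc => ?_) hst)
    by_contra hn
    exact hc (Or.inr hn)

/-- Halted outputs persist, so both events can be moved to a common later time, where they are
disjoint. -/
theorem run_add_outputProb_le_one (p : Program) (I : GraphInput) {A B : Set ℝ}
    (hAB : Disjoint A B) (t : ℕ) :
    (run p I t).toOuterMeasure {c | Halted p c ∧ output c ∈ A} + outputProb p I B ≤ 1 := by
  rw [outputProb, ENNReal.add_iSup]
  refine iSup_le fun s => ?_
  refine (add_le_add (monotone_run_of_halted p I (fun c hc => hc.1) (le_max_left t s))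
    (monotone_run_of_halted p I (fun c hc => hc.1) (le_max_right t s))).trans ?_
  simp only [toOuterMeasure_eq_expect, ← expect_add]
  refine expect_le_one _ fun c => ?_
  by_cases hA : output c ∈ A
  · have hB : output c ∉ B := fun hB => Set.disjoint_left.mp hAB hA hB
    simpa [hB] using indicator_one_le_one {c | Halted p c ∧ output c ∈ A} c
  · simpa [hA] using indicator_one_le_one {c | Halted p c ∧ output c ∈ B} c

/-- An algorithm that answers differently on `I` and on all the concealed inputs `J z` needs time
proportional to the number of the latter. -/
theorem Conceals.card_le {ι : Type*} [Fintype ι] {I : GraphInput} {J : ι → GraphInput}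
    (h : Conceals I J) {p : Program} {A : Set ℝ} {B : ι → Set ℝ} (hAB : ∀ z, Disjoint (B z) A)
    (hI : 2 / 3 ≤ outputProb p I A) (hJ : ∀ z, 2 / 3 ≤ outputProb p (J z) (B z))
    {t : ℕ} (ht : ∀ z, 6 * expectedTime p (J z) ≤ (t + 1 : ℕ)) : Fintype.card ι ≤ 6 * t := by
  obtain ⟨d, hd, hrun⟩ := h.exists_run_bound p t
  -- By time `t`, an output in `B z` has probability at least `2/3 - 1/6` on `J z` by Markov, but at
  -- most `1/3` on `I`; the gap is `1/6`.
  have key : ∀ z, (1 / 6 : ℝ≥0∞) ≤ d z := by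
    intro z
    have h1 := (hJ z).trans (outputProb_le p (J z) (B z) t)
    have h2 : (run p (J z) t).toOuterMeasure {c | ¬ Halted p c} ≤ 1 / 6 := by
      have hne : ((t + 1 : ℕ) : ℝ≥0∞) ≠ 0 := by simp
      have := (mul_le_mul_right (mul_not_halted_le_expectedTime p (J z) t) 6).trans (ht z)
      rw [mul_left_comm] at this
      have h3 : (6 : ℝ≥0∞) * (run p (J z) t).toOuterMeasure {c | ¬ Halted p c} ≤ 1 := by
        rwa [← ENNReal.mul_le_mul_iff_right hne (ENNReal.natCast_ne_top _), mul_one]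
      rw [ENNReal.le_div_iff_mul_le (by simp) (by simp), mul_comm]
      exact h3
    have h3 := hrun z _ (indicator_one_le_one {c | Halted p c ∧ output c ∈ B z})
    rw [← toOuterMeasure_eq_expect, ← toOuterMeasure_eq_expect] at h3
    have h4 := run_add_outputProb_le_one p I (hAB z) t
    have h5 := (add_le_add_right hI _).trans h4
    have ne : ∀ {x : ℝ≥0∞}, x ≤ 1 → x ≠ ∞ := fun hx => ne_top_of_le_ne_top ENNReal.one_ne_top hx
    have e1 : (run p I t).toOuterMeasure {c | Halted p c ∧ output c ∈ B z} ≠ ∞ :=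
      ne (le_self_add.trans h5)
    have e2 : (run p (J z) t).toOuterMeasure {c | ¬ Halted p c} ≠ ∞ :=
      ne (h2.trans (by simp))
    by_contra hlt
    rw [not_le] at hlt
    have e3 : d z ≠ ∞ := hlt.ne_top
    generalize (run p I t).toOuterMeasure {c | Halted p c ∧ output c ∈ B z} = x at *
    generalize (run p (J z) t).toOuterMeasure {c | Halted p c ∧ output c ∈ B z} = x' at *
    generalize (run p (J z) t).toOuterMeasure {c | ¬ Halted p c} = y at *
    generalize d z = w at *
    have h6 := h1.trans (add_le_add_left h3 y)
    lift x to NNReal using e1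
    lift y to NNReal using e2
    lift w to NNReal using e3
    have g1 : (x : ℝ) + 2 / 3 ≤ 1 := by
      have := ENNReal.toReal_mono (by simp) h5
      rw [ENNReal.toReal_add (by simp) (by simp [ENNReal.div_eq_top])] at this
      simpa using this
    have g2 : (y : ℝ) ≤ 1 / 6 := by
      have := ENNReal.toReal_mono (by simp) h2
      simpa using this
    have g3 : (w : ℝ) < 1 / 6 := by
      have := (ENNReal.toReal_lt_toReal (by simp) (by simp)).mpr hlt
      simpa using this
    have g4 : (2 / 3 : ℝ) ≤ x + w + y := by
      have := ENNReal.toReal_mono (by finiteness) h6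
      simpa [ENNReal.toReal_add] using this
    linarith
  have hsum : (Fintype.card ι : ℝ≥0∞) * (1 / 6) ≤ t := by
    refine le_trans ?_ hd
    rw [tsum_fintype, ← nsmul_eq_mul]
    exact Finset.card_nsmul_le_sum Finset.univ d (1 / 6) fun z _ => key z
  rw [mul_one_div, ENNReal.div_le_iff (by simp) (by simp)] at hsum
  rw [mul_comm]
  exact_mod_cast hsum

/-! ### Signed double covers -/

section Cover

variable {K : ℕ}

/-- The vertices of a double cover, in the order in which they are numbered. -/
noncomputable def coverEquiv (K : ℕ) : Fin (K * 2) ≃ Fin K × Bool :=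
  finProdFinEquiv.symm.trans ((Equiv.refl _).prodCongr finTwoEquiv)

/-- The double cover of `H` in which an edge in `S` joins vertices of equal sign and any other edge
joins vertices of opposite signs. -/
def coverGraph (H : SimpleGraph (Fin K)) (S : Set (Sym2 (Fin K))) :
    SimpleGraph (Fin (K * 2)) where
  Adj v w := H.Adj (coverEquiv K v).1 (coverEquiv K w).1 ∧
    ((coverEquiv K v).2 = (coverEquiv K w).2 ↔ s((coverEquiv K v).1, (coverEquiv K w).1) ∈ S)
  symm := ⟨fun v w h => ⟨h.1.symm, by rw [Sym2.eq_swap, ← h.2, eq_comm]⟩⟩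
  loopless := ⟨fun v h => H.loopless.irrefl _ h.1⟩

open Classical in
/-- The sign of the neighbour over `j` of a vertex with sign `b` over `i`. -/
noncomputable def coverSign (S : Set (Sym2 (Fin K))) (i j : Fin K) (b : Bool) : Bool :=
  if s(i, j) ∈ S then b else !b

open Classical in
/-- The edge of the double cover that belongs to the dart `(i, j)` of `H`. -/
noncomputable def coverEdge (S : Set (Sym2 (Fin K))) (d : Fin K × Fin K) :
    (Fin K × Bool) × (Fin K × Bool) :=
  -- The two darts of an edge must name its two lifts; the comparison gives them opposite signs.
  if s(d.1, d.2) ∈ S then ((d.1, decide (d.1 < d.2)), (d.2, decide (d.1 < d.2)))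
  else ((d.1, false), (d.2, true))

open Classical in
/-- The neighbours of `i` in `H`, in a fixed order. -/
noncomputable def neighborList (H : SimpleGraph (Fin K)) (i : Fin K) : List (Fin K) :=
  (Finset.univ.filter fun j => H.Adj i j).toList

open Classical in
/-- The darts of `H`, in a fixed order. -/
noncomputable def dartList (H : SimpleGraph (Fin K)) : List (Fin K × Fin K) :=
  (Finset.univ.filter fun d : Fin K × Fin K => H.Adj d.1 d.2).toList

theorem mem_neighborList {H : SimpleGraph (Fin K)} {i j : Fin K} :
    j ∈ neighborList H i ↔ H.Adj i j := by
  simp [neighborList]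

theorem mem_dartList {H : SimpleGraph (Fin K)} {d : Fin K × Fin K} :
    d ∈ dartList H ↔ H.Adj d.1 d.2 := by
  simp [dartList]

theorem coverEdge_injOn (H : SimpleGraph (Fin K)) (S : Set (Sym2 (Fin K))) {d d' : Fin K × Fin K}
    (hd : H.Adj d.1 d.2)
    (h : s((coverEdge S d).1, (coverEdge S d).2) = s((coverEdge S d').1, (coverEdge S d').2)) :
    d = d' := by
  obtain ⟨i, j⟩ := d
  obtain ⟨i', j'⟩ := d'
  have hne : i ≠ j := hd.ne
  have key : i = i' ∧ j = j' ∨ i = j' ∧ j = i' := by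
    unfold coverEdge at h
    split_ifs at h <;> simp only [Sym2.eq_iff, Prod.mk.injEq] at h <;> tauto
  rcases key with ⟨rfl, rfl⟩ | ⟨rfl, rfl⟩
  · rfl
  · exfalso
    by_cases hS : s(i, j) ∈ S
    · have hS' : s(j, i) ∈ S := by rwa [Sym2.eq_swap]
      simp only [coverEdge, hS, hS', if_true, Sym2.eq_iff, Prod.mk.injEq, decide_eq_decide] at h
      rcases lt_or_gt_of_ne hne with hlt | hlt <;> simp [hlt, hlt.not_gt, hne] at h
    · have hS' : s(j, i) ∉ S := by rwa [Sym2.eq_swap]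
      simp [coverEdge, hS, hS', hne] at h

/-- With `coverEdge_injOn`, this makes the darts of `H` enumerate the edges of every cover exactly
once, in an order free of `S`. -/
theorem exists_coverEdge_eq {H : SimpleGraph (Fin K)} {S : Set (Sym2 (Fin K))} {i j : Fin K}
    {a b : Bool} (hH : H.Adj i j) (hS : a = b ↔ s(i, j) ∈ S) :
    ∃ d : Fin K × Fin K, H.Adj d.1 d.2 ∧
      s((coverEdge S d).1, (coverEdge S d).2) = s((i, a), (j, b)) := by
  have hsw : s(j, i) ∈ S ↔ s(i, j) ∈ S := by rw [Sym2.eq_swap]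
  by_cases hab : a = b
  · have h1 := hS.mp hab
    have h2 := hsw.mpr h1
    subst hab
    by_cases hd : decide (i < j) = a
    · exact ⟨(i, j), hH, by simp [coverEdge, h1, hd]⟩
    · have hd' : decide (j < i) = a := by
        rcases lt_or_gt_of_ne hH.ne with hlt | hlt <;> cases a <;>
          simp_all [hlt.not_gt]
      exact ⟨(j, i), hH.symm, by simp only [coverEdge, h2, hd', if_true]; exact Sym2.eq_swap⟩
  · have h1 : s(i, j) ∉ S := fun h => hab (hS.mpr h)
    have h2 : s(j, i) ∉ S := fun h => h1 (hsw.mp h)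
    cases a <;> cases b
    · simp at hab
    · exact ⟨(i, j), hH, by simp [coverEdge, h1]⟩
    · exact ⟨(j, i), hH.symm, by simp only [coverEdge, h2, if_false]; exact Sym2.eq_swap⟩
    · simp at hab

theorem coverEdge_adj {H : SimpleGraph (Fin K)} (S : Set (Sym2 (Fin K))) {d : Fin K × Fin K}
    (hd : H.Adj d.1 d.2) :
    (coverGraph H S).Adj ((coverEquiv K).symm (coverEdge S d).1)
      ((coverEquiv K).symm (coverEdge S d).2) := by
  unfold coverEdge
  split_ifs with h <;> simp [coverGraph, h, hd]

/-- The double cover as an input; the orders of its lists do not depend on `S`. -/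
noncomputable def coverInput (H : SimpleGraph (Fin K)) (S : Set (Sym2 (Fin K))) : GraphInput where
  n := K * 2
  graph := coverGraph H S
  adj v := (neighborList H (coverEquiv K v).1).map fun j =>
    (coverEquiv K).symm (j, coverSign S (coverEquiv K v).1 j (coverEquiv K v).2)
  adj_nodup v := (Finset.nodup_toList _).map fun i j h => by
    simpa using congrArg Prod.fst ((coverEquiv K).symm.injective h)
  mem_adj v w := by
    simp only [List.mem_map, mem_neighborList, Equiv.symm_apply_eq, coverGraph, coverSign]
    constructor
    · rintro ⟨j, hj, hw⟩
      rw [← hw]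
      refine ⟨hj, ?_⟩
      split_ifs with h <;> simp [h]
    · rintro ⟨hH, hS⟩
      refine ⟨_, hH, Prod.ext rfl ?_⟩
      split_ifs with h
      · exact hS.mpr h
      · have := mt hS.mp h
        revert this
        cases (coverEquiv K v).2 <;> cases (coverEquiv K w).2 <;> simp
  edges := (dartList H).map fun d =>
    ((coverEquiv K).symm (coverEdge S d).1, (coverEquiv K).symm (coverEdge S d).2)
  edges_nodup := by
    rw [List.map_map]
    refine List.Nodup.map_on (fun d hd d' _ h => ?_) (Finset.nodup_toList _)
    refine coverEdge_injOn H S (mem_dartList.mp hd) ?_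
    exact Sym2.map.injective (coverEquiv K).symm.injective (by simpa using h)
  mem_edges e := by
    simp only [List.map_map, List.mem_map, mem_dartList, Function.comp_apply]
    constructor
    · rintro ⟨d, hd, rfl⟩
      exact coverEdge_adj S hd
    · induction e with | _ v w
      intro h
      obtain ⟨d, hd, hdd⟩ := exists_coverEdge_eq h.1 h.2
      refine ⟨d, hd, ?_⟩
      simpa using congrArg (Sym2.map (coverEquiv K).symm) hdd

theorem GraphInput.length_edges (I : GraphInput) : I.edges.length = I.m := by
  classical
  have h : I.graph.edgeSet = ((I.edges.map fun e => s(e.1, e.2)).toFinset : Set _) := by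
    ext e
    simp only [List.coe_toFinset, Set.mem_ofPred_eq, I.mem_edges]
  rw [GraphInput.m, h, Set.ncard_coe_finset, List.toFinset_card_of_nodup I.edges_nodup,
    List.length_map]

theorem coverInput_m (H : SimpleGraph (Fin K)) (S : Set (Sym2 (Fin K))) :
    (coverInput H S).m = (dartList H).length := by
  rw [← GraphInput.length_edges]
  exact List.length_map _

theorem elim_getElem?_map {α β γ : Type*} (l : List α) (f : α → β) (i : ℕ) (a : γ) (g : β → γ) :
    (l.map f)[i]?.elim a g = l[i]?.elim a fun x => g (f x) := by
  rw [List.getElem?_map]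
  cases l[i]? <;> rfl

theorem coverSign_insert {S : Set (Sym2 (Fin K))} {z : Sym2 (Fin K)} {i j : Fin K}
    (h : s(i, j) ≠ z) (b : Bool) : coverSign (insert z S) i j b = coverSign S i j b := by
  have key : s(i, j) ∈ insert z S ↔ s(i, j) ∈ S := by simp [h]
  unfold coverSign
  by_cases hS : s(i, j) ∈ S
  · rw [if_pos hS, if_pos (key.mpr hS)]
  · rw [if_neg hS, if_neg (mt key.mp hS)]

theorem coverEdge_insert {S : Set (Sym2 (Fin K))} {z : Sym2 (Fin K)} {d : Fin K × Fin K}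
    (h : s(d.1, d.2) ≠ z) : coverEdge (insert z S) d = coverEdge S d := by
  have key : s(d.1, d.2) ∈ insert z S ↔ s(d.1, d.2) ∈ S := by simp [h]
  unfold coverEdge
  by_cases hS : s(d.1, d.2) ∈ S
  · rw [if_pos hS, if_pos (key.mpr hS)]
  · rw [if_neg hS, if_neg (mt key.mp hS)]

theorem coverInput_T (H : SimpleGraph (Fin K)) (S : Set (Sym2 (Fin K))) :
    (coverInput H S).T = ((coverGraph H S).cliqueSet 3).ncard :=
  rfl

theorem coverInput_neighborQuery (H : SimpleGraph (Fin K)) (S : Set (Sym2 (Fin K))) (v : ℕ)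
    (hv : v < K * 2) (i : ℕ) :
    (coverInput H S).neighborQuery v i =
      (neighborList H (coverEquiv K ⟨v, hv⟩).1)[i]?.elim (K * 2) fun j =>
        (coverEquiv K).symm (j, coverSign S (coverEquiv K ⟨v, hv⟩).1 j (coverEquiv K ⟨v, hv⟩).2) := by
  rw [GraphInput.neighborQuery, dif_pos (show v < (coverInput H S).n from hv)]
  exact elim_getElem?_map _ _ _ _ _

theorem coverInput_edgeQuery (H : SimpleGraph (Fin K)) (S : Set (Sym2 (Fin K))) (i : ℕ) :
    (coverInput H S).edgeQuery i = (dartList H)[i]?.elim (K * 2, K * 2) fun d =>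
      (((coverEquiv K).symm (coverEdge S d).1 : ℕ), ((coverEquiv K).symm (coverEdge S d).2 : ℕ)) := by
  exact elim_getElem?_map _ _ _ _ _

/-- Adding one of many edges to `S` is concealed. -/
theorem conceals_insert {ι : Type*} (H : SimpleGraph (Fin K)) (S : Set (Sym2 (Fin K)))
    {z : ι → Sym2 (Fin K)} (hz : Function.Injective z) :
    Conceals (coverInput H S) fun a => coverInput H (insert (z a) S) where
  n_eq _ := rfl
  m_eq a := by rw [coverInput_m, coverInput_m]
  degree_eq a v := by simp [GraphInput.degreeQuery, coverInput]
  neighbor v i a ha b hb := by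
    -- A changed answer reveals `z c`: the position `(v, i)` determines one base edge, and only its
    -- membership in `S` matters.
    have key : ∀ c, (coverInput H (insert (z c) S)).neighborQuery v i ≠
        (coverInput H S).neighborQuery v i → ∃ (hv : v < K * 2) (j : Fin K),
        (neighborList H (coverEquiv K ⟨v, hv⟩).1)[i]? = some j ∧
          s((coverEquiv K ⟨v, hv⟩).1, j) = z c := by
      intro c hc
      by_cases hv : v < K * 2
      · refine ⟨hv, ?_⟩
        rcases hj : (neighborList H (coverEquiv K ⟨v, hv⟩).1)[i]? with _ | j
        · simp [coverInput_neighborQuery _ _ _ hv, hj] at hc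
        · refine ⟨j, rfl, ?_⟩
          by_contra hne
          simp [coverInput_neighborQuery _ _ _ hv, hj, coverSign_insert hne] at hc
      · simp [GraphInput.neighborQuery, coverInput, hv] at hc
    obtain ⟨hv, j, hj, hja⟩ := key a ha
    obtain ⟨_, j', hj', hjb⟩ := key b hb
    obtain rfl : j = j' := Option.some.inj (hj.symm.trans hj')
    exact hz (hja.symm.trans hjb)
  pair u v a ha b hb := by
    have key : ∀ c, (coverInput H (insert (z c) S)).pairQuery u v ≠
        (coverInput H S).pairQuery u v → ∃ (hu : u < K * 2) (hv : v < K * 2),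
          s((coverEquiv K ⟨u, hu⟩).1, (coverEquiv K ⟨v, hv⟩).1) = z c := by
      intro c hc
      by_contra! hne
      refine hc ?_
      unfold GraphInput.pairQuery
      congr 1
      refine propext (exists_congr fun hu => exists_congr fun hv => ?_)
      simp only [coverInput, coverGraph, Set.mem_insert_iff, hne hu hv, false_or]
    obtain ⟨hu, hv, h⟩ := key a ha
    obtain ⟨_, _, h'⟩ := key b hb
    exact hz (h.symm.trans h')
  edge i a ha b hb := by
    have key : ∀ c, (coverInput H (insert (z c) S)).edgeQuery i ≠
        (coverInput H S).edgeQuery i → ∃ d : Fin K × Fin K,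
        (dartList H)[i]? = some d ∧ s(d.1, d.2) = z c := by
      intro c hc
      rcases hd : (dartList H)[i]? with _ | d
      · simp [coverInput_edgeQuery, hd] at hc
      · refine ⟨d, rfl, ?_⟩
        by_contra hne
        simp [coverInput_edgeQuery, hd, coverEdge_insert hne] at hc
    obtain ⟨d, hd, hda⟩ := key a ha
    obtain ⟨d', hd', hdb⟩ := key b hb
    obtain rfl : d = d' := Option.some.inj (hd.symm.trans hd')
    exact hz (hda.symm.trans hdb)

/-- Every triangle of the cover lies over a triangle with an edge in `S`. -/
theorem exists_of_mem_cliqueSet {H : SimpleGraph (Fin K)} {S : Set (Sym2 (Fin K))}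
    {t : Finset (Fin (K * 2))} (ht : t ∈ (coverGraph H S).cliqueSet 3) :
    ∃ u v w, t = {u, v, w} ∧ s((coverEquiv K u).1, (coverEquiv K v).1) ∈ S ∧
      H.Adj (coverEquiv K u).1 (coverEquiv K v).1 ∧
      H.Adj (coverEquiv K u).1 (coverEquiv K w).1 := by
  rw [SimpleGraph.mem_cliqueSet_iff, SimpleGraph.is3Clique_iff] at ht
  obtain ⟨u, v, w, ⟨h1, h1'⟩, ⟨h2, h2'⟩, ⟨h3, h3'⟩, rfl⟩ := ht
  by_cases e1 : (coverEquiv K u).2 = (coverEquiv K v).2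
  · exact ⟨u, v, w, rfl, h1'.mp e1, h1, h2⟩
  by_cases e2 : (coverEquiv K u).2 = (coverEquiv K w).2
  · exact ⟨u, w, v, by rw [Finset.pair_comm], h2'.mp e2, h2, h1⟩
  -- Pigeonhole: among three vertices with two signs, two agree.
  · have e3 : (coverEquiv K v).2 = (coverEquiv K w).2 := by
      revert e1 e2
      cases (coverEquiv K u).2 <;> cases (coverEquiv K v).2 <;> cases (coverEquiv K w).2 <;> simp
    exact ⟨v, w, u, by rw [Finset.insert_comm, Finset.pair_comm u w],
      h3'.mp e3, h3, h1.symm⟩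

/-- Three vertices over a triangle with exactly one edge in `S` form a triangle. -/
theorem mem_cliqueSet_cover {H : SimpleGraph (Fin K)} {S : Set (Sym2 (Fin K))} {i j l : Fin K}
    (hij : H.Adj i j) (hil : H.Adj i l) (hjl : H.Adj j l) (h1 : s(i, j) ∈ S) (h2 : s(i, l) ∉ S)
    (h3 : s(j, l) ∉ S) :
    {(coverEquiv K).symm (i, false), (coverEquiv K).symm (j, false),
      (coverEquiv K).symm (l, true)} ∈ (coverGraph H S).cliqueSet 3 := by
  rw [SimpleGraph.mem_cliqueSet_iff, SimpleGraph.is3Clique_triple_iff]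
  simp [coverGraph, hij, hil, hjl, h1, h2, h3]

end Cover

/-! ### The hard inputs -/

section HardInput

variable {h : ℕ}

/-- The disjoint union of a clique on `2h` vertices and a triangle. -/
def cliqueAndTriangle (h : ℕ) : SimpleGraph (Fin (2 * h + 3)) where
  Adj i j := i ≠ j ∧ ((i : ℕ) < 2 * h ↔ (j : ℕ) < 2 * h)
  symm := ⟨fun _ _ h => ⟨h.1.symm, h.2.symm⟩⟩
  loopless := ⟨fun _ h => h.1 rfl⟩

/-- The first half of the clique. -/
def lowVertex (x : Fin h) : Fin (2 * h + 3) := ⟨x, by lia⟩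

/-- The second half of the clique. -/
def highVertex (y : Fin h) : Fin (2 * h + 3) := ⟨h + y, by lia⟩

/-- The vertices of the triangle. -/
def extraVertex (h : ℕ) (x : Fin 3) : Fin (2 * h + 3) := ⟨2 * h + x, by lia⟩

/-- The edges between the halves of the clique. -/
def crossEdge (z : Fin h × Fin h) : Sym2 (Fin (2 * h + 3)) := s(lowVertex z.1, highVertex z.2)

theorem crossEdge_injective : Function.Injective (crossEdge (h := h)) := by
  rintro ⟨x, y⟩ ⟨x', y'⟩ hxy
  simp only [crossEdge, lowVertex, highVertex, Sym2.eq_iff, Fin.mk.injEq] at hxy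
  ext <;> simp only <;> lia

/-- An edge of the triangle. -/
def extraEdge (h : ℕ) : Sym2 (Fin (2 * h + 3)) := s(extraVertex h 0, extraVertex h 1)

/-- An input with few triangles. -/
noncomputable def baseInput (h : ℕ) : GraphInput :=
  -- The marked extra edge keeps `T` positive; the accuracy guarantee is void on triangle-free
  -- inputs.
  coverInput (cliqueAndTriangle h) {extraEdge h}

/-- Inputs with many triangles. -/
noncomputable def hardInput (z : Fin h × Fin h) : GraphInput :=
  coverInput (cliqueAndTriangle h) (insert (crossEdge z) {extraEdge h})

theorem conceals_hardInput (h : ℕ) : Conceals (baseInput h) (hardInput (h := h)) :=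
  conceals_insert _ _ crossEdge_injective

theorem hardInput_n (z : Fin h × Fin h) : (hardInput z).n = 4 * h + 6 := by
  change (2 * h + 3) * 2 = _
  ring

theorem hardInput_m (z : Fin h × Fin h) :
    (hardInput z).m = (dartList (cliqueAndTriangle h)).length :=
  coverInput_m _ _

theorem length_dartList_le (h : ℕ) :
    (dartList (cliqueAndTriangle h)).length ≤ (2 * h + 3) ^ 2 := by
  rw [dartList, Finset.length_toList]
  refine (Finset.card_le_univ _).trans ?_
  simp [sq]

theorem le_length_dartList (h : ℕ) : h ^ 2 ≤ (dartList (cliqueAndTriangle h)).length := by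
  classical
  rw [dartList, Finset.length_toList]
  have := Finset.card_le_card_of_injOn (s := (Finset.univ : Finset (Fin h × Fin h)))
    (t := Finset.univ.filter fun d : Fin (2 * h + 3) × Fin (2 * h + 3) =>
      (cliqueAndTriangle h).Adj d.1 d.2) (fun z => (lowVertex z.1, highVertex z.2)) ?_ ?_
  · simpa [sq] using this
  · rintro ⟨x, y⟩ -
    refine Finset.mem_coe.mpr (Finset.mem_filter.mpr ⟨Finset.mem_univ _, ?_⟩)
    simp only [cliqueAndTriangle, lowVertex, highVertex, ne_eq, Fin.mk.injEq]
    lia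
  · rintro ⟨x, y⟩ - ⟨x', y'⟩ - hxy
    simp only [lowVertex, highVertex, Prod.mk.injEq, Fin.mk.injEq] at hxy
    ext <;> simp only <;> lia

open Classical in
/-- The vertices over the triangle. -/
noncomputable def extraPart (h : ℕ) : Finset (Fin ((2 * h + 3) * 2)) :=
  (Finset.univ ×ˢ Finset.univ).image fun x : Fin 3 × Bool =>
    (coverEquiv _).symm (extraVertex h x.1, x.2)

theorem mem_extraPart {v : Fin ((2 * h + 3) * 2)} (hv : ¬ ((coverEquiv _ v).1 : ℕ) < 2 * h) :
    v ∈ extraPart h := by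
  simp only [extraPart, Finset.mem_image, Finset.mem_product, Finset.mem_univ, true_and]
  refine ⟨(⟨(coverEquiv _ v).1 - 2 * h, by lia⟩, (coverEquiv _ v).2), ?_⟩
  rw [Equiv.symm_apply_eq]
  refine Prod.ext (Fin.ext ?_) rfl
  simp only [extraVertex]
  lia

/-- Six vertices lie over the extra triangle, hence `2 ^ 6` candidate sets; any constant would do.
-/
theorem card_powerset_extraPart (h : ℕ) : (extraPart h).powerset.card ≤ 64 := by
  rw [Finset.card_powerset]
  have : (extraPart h).card ≤ 6 := Finset.card_image_le.trans (by simp)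
  exact (Nat.pow_le_pow_right (by norm_num) this).trans (by norm_num)

/-- The extra triangle is a component of the base graph, so a triangle with an edge over `extraEdge`
stays above it. -/
theorem subset_extraPart {u v w : Fin ((2 * h + 3) * 2)}
    (h1 : s((coverEquiv _ u).1, (coverEquiv _ v).1) = extraEdge h)
    (h2 : (cliqueAndTriangle h).Adj (coverEquiv _ u).1 (coverEquiv _ v).1)
    (h3 : (cliqueAndTriangle h).Adj (coverEquiv _ u).1 (coverEquiv _ w).1) :
    ({u, v, w} : Finset _) ∈ (extraPart h).powerset := by
  have hu : ¬ ((coverEquiv _ u).1 : ℕ) < 2 * h := by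
    simp only [extraEdge, extraVertex, Sym2.eq_iff, Fin.ext_iff] at h1
    lia
  rw [Finset.mem_powerset]
  intro x hx
  simp only [Finset.mem_insert, Finset.mem_singleton] at hx
  rcases hx with rfl | rfl | rfl
  · exact mem_extraPart hu
  · exact mem_extraPart fun hv => hu (h2.2.mpr hv)
  · exact mem_extraPart fun hv => hu (h3.2.mpr hv)

theorem baseInput_T_le (h : ℕ) : (baseInput h).T ≤ 64 := by
  rw [baseInput, coverInput_T]
  refine le_trans ?_ (card_powerset_extraPart h)
  rw [← Set.ncard_coe_finset]
  refine Set.ncard_le_ncard (fun t ht => ?_) (Finset.finite_toSet _)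
  obtain ⟨u, v, w, rfl, h1, h2, h3⟩ := exists_of_mem_cliqueSet ht
  exact subset_extraPart h1 h2 h3

theorem baseInput_T_pos (h : ℕ) : 0 < (baseInput h).T := by
  rw [baseInput, coverInput_T, Set.ncard_pos (Set.toFinite _)]
  refine ⟨_, mem_cliqueSet_cover (i := extraVertex h 0) (j := extraVertex h 1)
    (l := extraVertex h 2) ?_ ?_ ?_ (Set.mem_singleton _) ?_ ?_⟩ <;>
  simp [cliqueAndTriangle, extraVertex, extraEdge]

/-- A triangle not over the extra one contains a lift of each end of the cross edge: four sign
choices, times an arbitrary third vertex. -/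
theorem hardInput_T_le (z : Fin h × Fin h) : (hardInput z).T ≤ 64 + 4 * ((2 * h + 3) * 2) := by
  classical
  let C : Finset (Finset (Fin ((2 * h + 3) * 2))) :=
    ((Finset.univ : Finset (Bool × Bool × Fin ((2 * h + 3) * 2)))).image fun x =>
      {(coverEquiv _).symm (lowVertex z.1, x.1), (coverEquiv _).symm (highVertex z.2, x.2.1), x.2.2}
  have hC : C.card ≤ 4 * ((2 * h + 3) * 2) := Finset.card_image_le.trans (by simp; lia)
  rw [hardInput, coverInput_T]
  refine le_trans ?_ (add_le_add (card_powerset_extraPart h) hC)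
  refine le_trans ?_ (Finset.card_union_le _ _)
  rw [← Set.ncard_coe_finset]
  refine Set.ncard_le_ncard (fun t ht => ?_) (Finset.finite_toSet _)
  obtain ⟨u, v, w, rfl, h1, h2, h3⟩ := exists_of_mem_cliqueSet ht
  rw [Finset.mem_coe, Finset.mem_union]
  rcases h1 with h1 | h1
  · right
    simp only [C, Finset.mem_image, Finset.mem_univ, true_and]
    rcases Sym2.eq_iff.mp h1 with ⟨hu, hv⟩ | ⟨hu, hv⟩
    · refine ⟨((coverEquiv _ u).2, (coverEquiv _ v).2, w), ?_⟩
      simp [← hu, ← hv]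
    · refine ⟨((coverEquiv _ v).2, (coverEquiv _ u).2, w), ?_⟩
      simp [← hu, ← hv, Finset.insert_comm]
  · left
    exact subset_extraPart h1 h2 h3

/-- Each other low vertex completes the cross edge to a base triangle with exactly one edge in `S`.
-/
theorem le_hardInput_T (z : Fin h × Fin h) : h - 1 ≤ (hardInput z).T := by
  classical
  obtain ⟨x, y⟩ := z
  have hcard : (Finset.univ.erase x).card = h - 1 := by simp
  rw [hardInput, coverInput_T, ← hcard, ← Set.ncard_coe_finset]
  refine Set.ncard_le_ncard_of_injOn (fun l => {(coverEquiv _).symm (lowVertex x, false),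
    (coverEquiv _).symm (highVertex y, false), (coverEquiv _).symm (lowVertex l, true)}) ?_ ?_
    (Set.toFinite _)
  · intro l hl
    have hl : l ≠ x := by simpa using hl
    have hl' : (l : ℕ) ≠ x := fun h => hl (Fin.ext h)
    refine mem_cliqueSet_cover ?_ ?_ ?_ (Set.mem_insert _ _) ?_ ?_ <;>
    simp [cliqueAndTriangle, lowVertex, highVertex, crossEdge, extraEdge, extraVertex] <;> lia
  · intro l _ l' _ hll
    -- The third vertex is recovered from the triangle as its only vertex of sign `true`.
    have : (coverEquiv _).symm (lowVertex l, true) ∈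
        ({(coverEquiv _).symm (lowVertex x, false), (coverEquiv _).symm (highVertex y, false),
          (coverEquiv _).symm (lowVertex l', true)} : Finset _) := by
      refine (Finset.ext_iff.mp hll _).mp ?_
      simp
    simpa [lowVertex, Fin.ext_iff] using this

end HardInput

/-! ### Growth rates and the bound on the exponent -/

/-- Two-sided bounds on `x` are needed because the sign of `r` is unknown. -/
theorem exists_rpow_le_mul_rpow {α β : ℝ} (hα : 0 < α) (r : ℝ) :
    ∃ D : ℝ, 0 ≤ D ∧ ∀ k x : ℝ, 0 < k → α * k ≤ x → x ≤ β * k → x ^ r ≤ D * k ^ r := by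
  refine ⟨max (α ^ r) (β ^ r), (Real.rpow_nonneg hα.le r).trans (le_max_left _ _),
    fun k x hk h1 h2 => ?_⟩
  have hx : x = x / k * k := by field_simp
  have h1' : α ≤ x / k := (le_div_iff₀ hk).mpr h1
  have h2' : x / k ≤ β := (div_le_iff₀ hk).mpr h2
  have h0 : 0 < x / k := hα.trans_le h1'
  rw [hx, Real.mul_rpow h0.le hk.le]
  refine mul_le_mul_of_nonneg_right ?_ (Real.rpow_nonneg hk.le r)
  rcases le_total 0 r with hr | hr
  · exact (Real.rpow_le_rpow h0.le h2' hr).trans (le_max_right _ _)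
  · exact (Real.rpow_le_rpow_of_nonpos hα h1' hr).trans (le_max_left _ _)

/-- A constant factor approximation algorithm needs quadratic time on the hard inputs. -/
theorem sq_le_of_hardInput_time {p : Program} {c : ℝ} (hc : 1 ≤ c)
    (hp : ∀ I : GraphInput, 0 < I.T →
      2 / 3 ≤ outputProb p I (Set.Icc ((I.T : ℝ) / c) (c * (I.T : ℝ)))) {h : ℕ}
    (hh : c ^ 2 * 64 < h - 1) {B : ℝ} (hB0 : 0 ≤ B)
    (hB : ∀ z : Fin h × Fin h, expectedTime p (hardInput z) ≤ ENNReal.ofReal B) :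
    (h : ℝ) ^ 2 ≤ 36 * B + 6 := by
  have hc0 : 0 < c := by linarith
  have hT : ∀ z : Fin h × Fin h, c ^ 2 * 64 < (hardInput z).T := fun z => by
    have h1 : h ≤ (hardInput z).T + 1 := Nat.sub_le_iff_le_add.mp (le_hardInput_T z)
    have h2 : (h : ℝ) ≤ (hardInput z).T + 1 := by exact_mod_cast h1
    linarith
  -- This `t` meets the Markov requirement. The answer intervals are disjoint because the triangle
  -- counts differ by a factor above `c ^ 2`.
  have key := (conceals_hardInput h).card_le (p := p) (t := ⌈6 * B⌉₊) (fun z => ?_)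
    (hp _ (baseInput_T_pos h)) (fun z => hp (hardInput z) ?_) (fun z => ?_)
  · rw [Fintype.card_prod, Fintype.card_fin, ← sq] at key
    have h1 : (h : ℝ) ^ 2 ≤ 6 * ⌈6 * B⌉₊ := by exact_mod_cast key
    have h2 := Nat.ceil_lt_add_one (show 0 ≤ 6 * B by positivity)
    linarith
  · rw [Set.disjoint_left]
    intro x hx hx'
    have h1 : (hardInput z).T ≤ c * x := by
      have := (div_le_iff₀ hc0).mp hx.1
      linarith
    have h2 : ((baseInput h).T : ℝ) ≤ 64 := by exact_mod_cast baseInput_T_le h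
    have h3 : c * x ≤ c * (c * 64) :=
      mul_le_mul_of_nonneg_left (hx'.2.trans (mul_le_mul_of_nonneg_left h2 hc0.le)) hc0.le
    have := hT z
    nlinarith
  · have h1 : (0 : ℝ) < (hardInput z).T := lt_of_le_of_lt (by positivity) (hT z)
    exact_mod_cast h1
  · calc 6 * expectedTime p (hardInput z) ≤ 6 * ENNReal.ofReal B := mul_le_mul_right (hB z) 6
      _ = ENNReal.ofReal (6 * B) := by
        rw [ENNReal.ofReal_mul (by norm_num)]
        simp
      _ ≤ ENNReal.ofReal ((⌈6 * B⌉₊ + 1 : ℕ) : ℝ) := by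
        refine ENNReal.ofReal_le_ofReal ((Nat.le_ceil _).trans ?_)
        push_cast
        linarith
      _ = _ := ENNReal.ofReal_natCast _

/-- If the number of triangles can be approximated in time `Õ(m ^ a / T ^ δ)`, then this is `Ω(m)`
up to lower order factors for `T = √m`. -/
theorem two_le_of_approx {p : Program} {a δ : ℝ} (hp : IsConstantFactorApprox p)
    (ht : RunsInSoftO p fun m T => (m : ℝ) ^ a / (T : ℝ) ^ δ) : 2 ≤ 2 * a - δ := by
  by_contra! hlt
  obtain ⟨c, hc, hp⟩ := hp
  obtain ⟨C, e, N, he, ht⟩ := ht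
  obtain ⟨ε, hε, hε1, hεa⟩ : ∃ ε : ℝ, 0 < ε ∧ ε ≤ 1 ∧ ε + (2 * a - δ) ≤ 2 - ε :=
    ⟨min 1 ((2 - (2 * a - δ)) / 2), lt_min one_pos (by linarith), min_le_left _ _, by
      linarith [min_le_right 1 ((2 - (2 * a - δ)) / 2)]⟩
  -- For `h ≥ 2`, `n = 4h + 6` lies in `[4h, 10h]`, `m` in `[h ^ 2, 25h ^ 2]`, and `T` in `[h / 2,
  -- 112h]`.
  obtain ⟨D₁, hD₁, h₁⟩ := exists_rpow_le_mul_rpow (α := 4) (β := 10) (by norm_num) ε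
  obtain ⟨D₂, hD₂, h₂⟩ := exists_rpow_le_mul_rpow (α := 1) (β := 25) (by norm_num) a
  obtain ⟨D₃, hD₃, h₃⟩ := exists_rpow_le_mul_rpow (α := 1 / 2) (β := 112) (by norm_num) (-δ)
  set D := |C| * D₁ * D₂ * D₃ with hD
  have hD0 : 0 ≤ D := by positivity
  have hn : Tendsto (fun h : ℕ => 4 * h + 6) atTop atTop :=
    tendsto_atTop_mono (fun h => by simp only [id]; lia) tendsto_id
  have ev1 := (he.comp hn).eventually_le_const hε
  have ev2 := hn.eventually_ge_atTop N
  have ev3 := (tendsto_natCast_atTop_atTop (R := ℝ)).eventually_gt_atTop (c ^ 2 * 64 + 1)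
  have ev4 := ((tendsto_rpow_atTop hε).comp
    (tendsto_natCast_atTop_atTop (R := ℝ))).eventually_gt_atTop (36 * D + 6)
  obtain ⟨h, e1, e2, e3, e4, h2⟩ :=
    (ev1.and (ev2.and (ev3.and (ev4.and (eventually_ge_atTop 2))))).exists
  simp only [Function.comp_apply] at e1 e4
  have h2' : (2 : ℝ) ≤ h := by exact_mod_cast h2
  have h0 : (0 : ℝ) < h := by linarith
  have time : ∀ z : Fin h × Fin h,
      expectedTime p (hardInput z) ≤ ENNReal.ofReal (D * (h : ℝ) ^ (2 - ε)) := by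
    intro z
    have hT1 : (h : ℝ) ≤ (hardInput z).T + 1 := by
      exact_mod_cast Nat.sub_le_iff_le_add.mp (le_hardInput_T z)
    have hT2 : ((hardInput z).T : ℝ) ≤ 64 + 4 * ((2 * h + 3) * 2) := by
      exact_mod_cast hardInput_T_le z
    have hm1 : (h : ℝ) ^ 2 ≤ (hardInput z).m := by
      rw [hardInput_m]
      exact_mod_cast le_length_dartList h
    have hm2 : ((hardInput z).m : ℝ) ≤ (2 * h + 3) ^ 2 := by
      rw [hardInput_m]
      exact_mod_cast length_dartList_le h
    have hTpos : (0 : ℝ) < (hardInput z).T := by linarith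
    refine (ht (hardInput z) (by rwa [hardInput_n]) (by exact_mod_cast hTpos)).trans
      (ENNReal.ofReal_le_ofReal ?_)
    beta_reduce
    rw [hardInput_n, div_eq_mul_inv, ← Real.rpow_neg hTpos.le]
    have g1 : ((4 * h + 6 : ℕ) : ℝ) ^ e (4 * h + 6) ≤ D₁ * (h : ℝ) ^ ε := by
      refine (Real.rpow_le_rpow_of_exponent_le ?_ e1).trans (h₁ h _ h0 ?_ ?_) <;>
        push_cast <;> linarith
    have g2 : ((hardInput z).m : ℝ) ^ a ≤ D₂ * (h : ℝ) ^ (2 * a) := by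
      refine (h₂ (h ^ 2) _ (by positivity) (by linarith) (by nlinarith)).trans_eq ?_
      rw [Real.rpow_mul h0.le, Real.rpow_two]
    have g3 : ((hardInput z).T : ℝ) ^ (-δ) ≤ D₃ * (h : ℝ) ^ (-δ) :=
      h₃ h _ h0 (by linarith) (by linarith)
    calc C * ((4 * h + 6 : ℕ) : ℝ) ^ e (4 * h + 6) *
          (((hardInput z).m : ℝ) ^ a * ((hardInput z).T : ℝ) ^ (-δ))
        ≤ |C| * (D₁ * (h : ℝ) ^ ε) * (D₂ * (h : ℝ) ^ (2 * a) * (D₃ * (h : ℝ) ^ (-δ))) := by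
          gcongr
          exact le_abs_self C
      _ = D * (h : ℝ) ^ (ε + (2 * a - δ)) := by
          rw [sub_eq_add_neg, Real.rpow_add h0, Real.rpow_add h0, hD]
          ring
      _ ≤ D * (h : ℝ) ^ (2 - ε) := by
          gcongr
          linarith
  have key := sq_le_of_hardInput_time hc hp (by linarith) (by positivity) time
  -- Since `h ^ ε > 36 * D + 6` and `h ^ (2 - ε) ≥ 1`, this product exceeds the upper bound in
  -- `key`.
  have hpow : (h : ℝ) ^ 2 = (h : ℝ) ^ ε * (h : ℝ) ^ (2 - ε) := by
    rw [← Real.rpow_add h0, ← Real.rpow_two]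
    congr 1
    ring
  have hone : 1 ≤ (h : ℝ) ^ (2 - ε) := Real.one_le_rpow (by linarith) (by linarith)
  nlinarith

end TriangleCounting

open TriangleCounting in
theorem mainTheorem10 (R : Type*) [CommRing R] [Nontrivial R] (δ : ℝ)
    (h : ∃ p : Program, IsConstantFactorApprox p ∧
      RunsInSoftO p (fun m T =>
        (m : ℝ) ^ (2 * matMulExponent R / (matMulExponent R + 1)) / (T : ℝ) ^ δ)) :
    δ ≤ 2 * (matMulExponent R - 1) / (matMulExponent R + 1) := by
  obtain ⟨p, hp, ht⟩ := h
  have key := two_le_of_approx hp ht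
  generalize matMulExponent R = w at key
  -- If `w = -1`, both quotients are `0` by convention, and `key` gives `δ ≤ -2`.
  by_cases hw : w + 1 = 0
  · rw [hw, div_zero] at key ⊢
    linarith
  · have : 2 * (w - 1) / (w + 1) = 2 * (2 * w / (w + 1)) - 2 := by
      field_simp
      ring
    linarith
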